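/- **Setting.** A labelled graph consists of a directed graph (nonempty sets $\mathcal E^0$ of vertices and $\mathcal E^1$ of edges, source and range maps $s,r$) and a surjective labelling $\mathcal L:\mathcal E^1\to\mathcal A$. Let $\mathcal L^*$ be the set of labels of finite paths, including the empty word $\varepsilon$. For $A\subseteq\mathcal E^0$ and $\alpha\in\mathcal L^*$, $r(A,\alpha)$ is the set of ranges of the paths with label $\alpha$ that start in $A$ (so $r(A,\varepsilon)=A$), and $r(\alpha)=r(\mathcal E^0,\alpha)$. Let $(\mathcal E,\mathcal L,\mathcal B)$ be a weakly left-resolving normal labelled space: $\mathcal B$ is a family of subsets of $\mathcal E^0$ that contains $r(\alpha)$ for all $\alpha\in\mathcal L^*\setminus\{\varepsilon\}$, is closed under finite unions, finite intersections, relative complements and $A\mapsto r(A,\alpha)$, and satisfies $r(A\cap B,\alpha)=r(A,\alpha)\cap r(B,\alpha)$ for $A,B\in\mathcal B$ and $\alpha\in\mathcal L^*\setminus\{\varepsilon\}$. Put $\mathcal B_\alpha=\{A\in\mathcal B: A\subseteq r(\alpha)\}$. Let $S=\{(\alpha,A,\beta):\alpha,\beta\in\mathcal L^*,\ \emptyset\ne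 A\in\mathcal B_\alpha\cap\mathcal B_\beta\}\cup\{0\}$ with the product $$(\alpha,A,\beta)(\gamma,B,\delta)=\begin{cases}(\alpha\gamma',r(A,\gamma')\cap B,\delta)&\text{if }\gamma=\beta\gamma',\ r(A,\gamma')\cap B\neq\emptyset,\\(\alpha,A\cap r(B,\beta'),\delta\beta')&\text{if }\beta=\gamma\beta',\ A\cap r(B,\beta')\ne\emptyset,\\0&\text{otherwise,}\end{cases}$$ where $0$ is a zero element. Its semilattice of idempotents is $E(S)=\{(\alpha,A,\alpha)\in S\}\cup\{0\}$. A filter in $E(S)$ is a nonempty subset of $E(S)$ that does not contain $0$, is closed under meets and is an upper set. The set of filters carries the topology of pointwise convergence of characteristic functions on $E(S)$. The space $\mathsf T$ of tight filters is the closure of the set of ultrafilters (maximal filters), with the subspace topology. For $e\in E(S)$ let $V_e=\{\xi\in\mathsf T: e\in\xi\}$. The word associated with a filter $\xi$ is the finite or infinite word $\alpha$ whose nonempty finite beginnings are exactly the nonempty words $\beta$ with $(\beta,A,\beta)\in\xi$ for some $A$; write $\xi=\xi^\alpha$. For $0\le n\le|\alpha|$, $n<\infty$, put $\xi_n=\{A\in\mathcal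 B:(\alpha_{1,n},A,\alpha_{1,n})\in\xi\}$, where $\alpha_{1,n}$ is the beginning of $\alpha$ of length $n$. For a filter $\xi$ with associated word $\alpha\gamma$, $\alpha$ finite, put $H_{[\varepsilon]\gamma}(\xi)=\xi$ and, for $\alpha\neq\varepsilon$, $$H_{[\alpha]\gamma}(\xi)=\{(\gamma_{1,n},C,\gamma_{1,n}) : 0\le n\le|\gamma|,\ n<\infty,\ C\in\mathcal B_{\gamma_{1,n}},\ C\neq\emptyset,\ D\subseteq C\text{ for some }D\in\xi_{|\alpha|+n}\}.$$ Let $\mathsf T^{(1)}=\{\xi^\alpha\in\mathsf T:|\alpha|\ge1\}$ and $$\Gamma=\{(\xi^{\alpha\gamma},|\alpha|-|\beta|,\eta^{\beta\gamma})\in\mathsf T\times\mathbb Z\times\mathsf T : H_{[\alpha]\gamma}(\xi)=H_{[\beta]\gamma}(\eta)\}.$$ **Proposition.** (i) $\mathsf T^{(1)}$ is open in $\mathsf T$. (ii) For $\xi=\xi^{a\gamma}\in\mathsf T^{(1)}$ with $a\in\mathcal A$, the set $\sigma(\xi)=H_{[a]\gamma}(\xi)$ is a tight filter, and the map $\sigma:\mathsf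 T^{(1)}\to\mathsf T$ so defined is a local homeomorphism. For every $a\in\mathcal A$, $V_{(a,r(a),a)}\subseteq\mathsf T^{(1)}$ and $\sigma$ restricts to a homeomorphism from $V_{(a,r(a),a)}$ onto $V_{(\varepsilon,r(a),\varepsilon)}$. (iii) As a set, $\Gamma$ is the Renault–Deaconu groupoid of $\sigma$: $$\Gamma=\{(\eta,m-n,\xi) : m,n\in\mathbb N,\ \eta\in\operatorname{dom}(\sigma^m),\ \xi\in\operatorname{dom}(\sigma^n),\ \sigma^m(\eta)=\sigma^n(\xi)\}.$$ -/

import Mathlib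

/-- A labelled graph: a directed graph with vertex set `V`, a nonempty edge set `E`, source and
range maps, and a surjective labelling of the edges by the alphabet `𝓐`. -/
structure LabelledGraph (V E 𝓐 : Type*) where
  src : E → V
  rng : E → V
  lab : E → 𝓐
  edge_nonempty : Nonempty E
  lab_surjective : Function.Surjective lab

namespace LabelledGraph

variable {V E 𝓐 : Type*} (G : LabelledGraph V E 𝓐)

/-- `G.IsPath v p w`: the list of edges `p` is a finite path from `v` to `w`;
the path of length zero at `v` is the empty list, from `v` to `v`. -/
inductive IsPath : V → List E → V → Prop
  | nil (v : V) : IsPath v [] v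
  | cons (e : E) {p : List E} {w : V} : IsPath (G.rng e) p w → IsPath (G.src e) (e :: p) w

/-- Finite labelled paths, that is, labels of finite paths (the empty word included). -/
def IsLabelledPath (α : List 𝓐) : Prop :=
  ∃ v p w, G.IsPath v p w ∧ p.map G.lab = α

/-- The relative range `r(A, α)`; for the empty word it is `A`. -/
def relRange (A : Set V) (α : List 𝓐) : Set V :=
  {w | ∃ v ∈ A, ∃ p, G.IsPath v p w ∧ p.map G.lab = α}

/-- The range `r(α)`; for the empty word it is the set of all vertices. -/
def range (α : List 𝓐) : Set V := G.relRange Set.univ α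

theorem isPath_nil_iff {v w : V} : G.IsPath v [] w ↔ v = w := by
  constructor
  · intro h
    cases h
    rfl
  · rintro rfl
    exact IsPath.nil v

theorem relRange_nil (A : Set V) : G.relRange A [] = A := by
  ext w
  constructor
  · rintro ⟨v, hv, p, hp, hl⟩
    obtain rfl : p = [] := List.map_eq_nil_iff.1 hl
    obtain rfl := G.isPath_nil_iff.1 hp
    exact hv
  · intro hw
    exact ⟨w, hw, [], IsPath.nil w, rfl⟩

theorem relRange_mono {A B : Set V} (h : A ⊆ B) (α : List 𝓐) :
    G.relRange A α ⊆ G.relRange B α := by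
  rintro w ⟨v, hv, p, hp⟩
  exact ⟨v, h hv, p, hp⟩

theorem IsPath.append {u v w : V} {p q : List E} (hp : G.IsPath u p v) (hq : G.IsPath v q w) :
    G.IsPath u (p ++ q) w := by
  induction hp with
  | nil v => exact hq
  | cons e _ ih => exact IsPath.cons e (ih hq)

theorem relRange_range_subset (α β : List 𝓐) :
    G.relRange (G.range α) β ⊆ G.range (α ++ β) := by
  rintro w ⟨v, ⟨u, hu, p, hp, hpl⟩, q, hq, hql⟩
  exact ⟨u, hu, p ++ q, hp.append G hq, by rw [List.map_append, hpl, hql]⟩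

theorem isLabelledPath_of_nonempty {A : Set V} {α : List 𝓐} (h : (G.relRange A α).Nonempty) :
    G.IsLabelledPath α := by
  obtain ⟨w, v, _, p, hp, hl⟩ := h
  exact ⟨v, p, w, hp, hl⟩

theorem range_singleton_nonempty (a : 𝓐) : (G.range [a]).Nonempty := by
  obtain ⟨e, rfl⟩ := G.lab_surjective a
  exact ⟨G.rng e, G.src e, Set.mem_univ _, [e], IsPath.cons e (IsPath.nil _), rfl⟩

theorem isLabelledPath_nil : G.IsLabelledPath [] := by
  obtain ⟨e⟩ := G.edge_nonempty
  exact ⟨G.src e, [], G.src e, IsPath.nil _, rfl⟩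

end LabelledGraph

/-- A labelled space: a labelled graph with a family `sets` of sets of vertices that is closed
under finite intersections, finite unions and relative ranges and contains every `r(α)` with `α`
a labelled path of length at least one. -/
structure LabelledSpace (V E 𝓐 : Type*) extends LabelledGraph V E 𝓐 where
  sets : Set (Set V)
  inter_mem : ∀ A ∈ sets, ∀ B ∈ sets, A ∩ B ∈ sets
  union_mem : ∀ A ∈ sets, ∀ B ∈ sets, A ∪ B ∈ sets
  range_mem : ∀ α, toLabelledGraph.IsLabelledPath α → α ≠ [] → toLabelledGraph.range α ∈ sets
  relRange_mem : ∀ A ∈ sets, ∀ α, toLabelledGraph.IsLabelledPath α →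
    toLabelledGraph.relRange A α ∈ sets

/-- Finite or infinite words over the alphabet `𝓐`. -/
inductive LWord (𝓐 : Type*)
  | fin : List 𝓐 → LWord 𝓐
  | inf : Stream' 𝓐 → LWord 𝓐

namespace LWord

variable {𝓐 : Type*}

/-- The length of a word. -/
def length : LWord 𝓐 → ℕ∞
  | fin l => (l.length : ℕ∞)
  | inf _ => ⊤

/-- `prepend α γ` is the concatenation `αγ` of a finite word and a finite or infinite word. -/
def prepend (α : List 𝓐) : LWord 𝓐 → LWord 𝓐
  | fin l => fin (α ++ l)
  | inf x => inf (α ++ₛ x)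

/-- The finite word `β` is a beginning of `α`. -/
def IsBeginning (β : List 𝓐) (α : LWord 𝓐) : Prop := ∃ γ, α = prepend β γ

end LWord

namespace LabelledSpace

variable {V E 𝓐 : Type*} (L : LabelledSpace V E 𝓐)

/-- The family of sets is closed under relative complements. -/
def IsNormal : Prop := ∀ A ∈ L.sets, ∀ B ∈ L.sets, A \ B ∈ L.sets

/-- `r(A ∩ B, α) = r(A, α) ∩ r(B, α)` for all `A`, `B` in the family and all labelled paths `α`
of length at least one. -/
def IsWeaklyLeftResolving : Prop :=
  ∀ A ∈ L.sets, ∀ B ∈ L.sets, ∀ α, L.IsLabelledPath α → α ≠ [] →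
    L.relRange (A ∩ B) α = L.relRange A α ∩ L.relRange B α

/-- The sets of the family that are contained in `r(α)`. -/
def setsOf (α : List 𝓐) : Set (Set V) := {A | A ∈ L.sets ∧ A ⊆ L.range α}

/-- `(α, A, β)` is a nonzero element of the inverse semigroup. -/
structure IsTriple (α : List 𝓐) (A : Set V) (β : List 𝓐) : Prop where
  left : L.IsLabelledPath α
  right : L.IsLabelledPath β
  mem_left : A ∈ L.setsOf α
  mem_right : A ∈ L.setsOf β
  nonempty : A.Nonempty

/-- The underlying set `S` of the inverse semigroup of the labelled space. -/
inductive S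
  | zero : S
  | triple (α : List 𝓐) (A : Set V) (β : List 𝓐) (h : L.IsTriple α A β) : S

variable {L}

theorem IsTriple.swap {α β : List 𝓐} {A : Set V} (h : L.IsTriple α A β) : L.IsTriple β A α :=
  ⟨h.right, h.left, h.mem_right, h.mem_left, h.nonempty⟩

theorem IsTriple.mul {α β γ' δ : List 𝓐} {A B : Set V} (hA : L.IsTriple α A β)
    (hB : L.IsTriple (β ++ γ') B δ) (hne : (L.relRange A γ' ∩ B).Nonempty) :
    L.IsTriple (α ++ γ') (L.relRange A γ' ∩ B) δ := by
  have hsub : L.relRange A γ' ∩ B ⊆ L.range (α ++ γ') :=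
    Set.inter_subset_left.trans
      ((L.relRange_mono hA.mem_left.2 γ').trans (L.relRange_range_subset α γ'))
  have hmem : L.relRange A γ' ∩ B ∈ L.sets :=
    L.inter_mem _ (L.relRange_mem A hA.mem_left.1 γ'
      (L.isLabelledPath_of_nonempty (hne.mono Set.inter_subset_left))) _ hB.mem_right.1
  exact ⟨L.isLabelledPath_of_nonempty (A := Set.univ) (hne.mono hsub), hB.right, ⟨hmem, hsub⟩,
    ⟨hmem, Set.inter_subset_right.trans hB.mem_right.2⟩, hne⟩

theorem IsTriple.mul' {α β' γ δ : List 𝓐} {A B : Set V} (hA : L.IsTriple α A (γ ++ β'))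
    (hB : L.IsTriple γ B δ) (hne : (A ∩ L.relRange B β').Nonempty) :
    L.IsTriple α (A ∩ L.relRange B β') (δ ++ β') := by
  rw [Set.inter_comm] at hne ⊢
  exact (hB.swap.mul hA.swap hne).swap

open Classical in
/-- The product of `S`. In `(α, A, β)(γ, B, δ)` the product is
`(αγ', r(A, γ') ∩ B, δ)` if `γ = βγ'` and the middle set is nonempty, it is
`(α, A ∩ r(B, β'), δβ')` if `β = γβ'` and the middle set is nonempty, and it is zero otherwise
(if `β = γ` the first two cases agree). -/
noncomputable def S.mul : L.S → L.S → L.S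
  | .zero, _ => .zero
  | .triple _ _ _ _, .zero => .zero
  | .triple α A β hA, .triple γ B δ hB =>
    if h : ∃ γ', γ = β ++ γ' ∧ (L.relRange A γ' ∩ B).Nonempty then
      .triple (α ++ h.choose) (L.relRange A h.choose ∩ B) δ
        (hA.mul (h.choose_spec.1 ▸ hB) h.choose_spec.2)
    else if h : ∃ β', β = γ ++ β' ∧ (A ∩ L.relRange B β').Nonempty then
      .triple α (A ∩ L.relRange B h.choose) (δ ++ h.choose)
        (IsTriple.mul' (h.choose_spec.1 ▸ hA) hB h.choose_spec.2)
    else .zero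

noncomputable instance : Mul L.S := ⟨S.mul⟩

instance : Zero L.S := ⟨S.zero⟩

variable (L)

/-- The semilattice `E(S)` of idempotents of `S`. -/
def idem : Set L.S := {s | s = 0 ∨ ∃ α A h, s = S.triple α A α h}

/-- Filters in the semilattice `E(S)`: nonempty subsets that do not contain `0`, are closed under
meets (products) and are upper sets for the natural order (`e ≤ f` if and only if `ef = e`). -/
structure IsFilter (ξ : Set L.S) : Prop where
  subset : ξ ⊆ L.idem
  nonempty : ξ.Nonempty
  zero_notMem : (0 : L.S) ∉ ξ
  mul_mem : ∀ e ∈ ξ, ∀ f ∈ ξ, e * f ∈ ξ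
  mem_of_le : ∀ e ∈ ξ, ∀ f ∈ L.idem, e * f = e → f ∈ ξ

/-- The set of all filters in `E(S)`. -/
def Filt : Type _ := {ξ : Set L.S // L.IsFilter ξ}

open Classical in
/-- The character of `E(S)` that corresponds to a filter. -/
noncomputable def Filt.char (ξ : L.Filt) : L.idem → Bool := fun e => decide (e.1 ∈ ξ.1)

/-- The topology of pointwise convergence of the corresponding characters. -/
noncomputable instance : TopologicalSpace L.Filt :=
  TopologicalSpace.induced (Filt.char L) inferInstance

/-- The tight filters: the closure of the set of ultrafilters (that is, maximal filters). -/
def tightSet : Set L.Filt := closure {ξ | ∀ η : L.Filt, ξ.1 ⊆ η.1 → η.1 = ξ.1}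

/-- The space of tight filters in `E(S)`, with the subspace topology. -/
abbrev Tight : Type _ := ↥L.tightSet

/-- The basic open set `V_e` of the tight filters that contain `e`. -/
def basicOpen (e : L.S) : Set L.Tight := {ξ | e ∈ ξ.1.1}

/-- `comp ξ β` is the set of all `A` with `(β, A, β) ∈ ξ`. If `α` is the word associated with the
filter `ξ` and `β = α_{1,n}`, this is the member `ξ_n` of the complete family of `ξ`. -/
def comp (ξ : Set L.S) (β : List 𝓐) : Set (Set V) := {A | ∃ h, S.triple β A β h ∈ ξ}

/-- `α` is the word associated with the filter `ξ`: the nonempty beginnings of `α` are exactly the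
nonempty words `β` such that `(β, A, β) ∈ ξ` for some `A`. (For the empty word there need not be
such an `A`: the filter `ξ_0` may be empty.) -/
def HasWord (ξ : Set L.S) (α : LWord 𝓐) : Prop :=
  ∀ β : List 𝓐, β ≠ [] → ((L.comp ξ β).Nonempty ↔ LWord.IsBeginning β α)

/-- `h_{[α]β}(F)`: all sets in the family of subsets of `r(β)` that contain a member of `F`. -/
def cutFilter (β : List 𝓐) (F : Set (Set V)) : Set (Set V) :=
  {C | C ∈ L.setsOf β ∧ ∃ D ∈ F, D ⊆ C}

/-- `H_{[α]γ}(ξ)` for a filter `ξ` with associated word `αγ`: cut `α` from the beginning. It is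
`ξ` if `α` is empty, and otherwise it consists of all `(γ_{1,n}, C, γ_{1,n})` with
`0 ≤ n ≤ |γ|` (`n` finite) and `C ∈ h_{[α]γ_{1,n}}(ξ_{|α|+n})`. -/
def cut (α : List 𝓐) (γ : LWord 𝓐) (ξ : Set L.S) : Set L.S :=
  {e | (α = [] ∧ e ∈ ξ) ∨ (α ≠ [] ∧ ∃ β, LWord.IsBeginning β γ ∧
    ∃ C ∈ L.cutFilter β (L.comp ξ (α ++ β)), ∃ h, e = S.triple β C β h)}

/-- The set of the tight filters whose associated word has length at least `n`. -/
def tightGE (n : ℕ) : Set L.Tight := {ξ | ∃ α, L.HasWord ξ.1.1 α ∧ (n : ℕ∞) ≤ α.length}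

/-- The groupoid `Γ`, as a set: all `(ξ, |α| - |β|, η)` where `ξ`, `η` are tight filters with
associated words `αγ`, `βγ` and `H_{[α]γ}(ξ) = H_{[β]γ}(η)`. -/
def groupoidSet : Set (L.Tight × ℤ × L.Tight) :=
  {g | ∃ (α β : List 𝓐) (γ : LWord 𝓐),
    L.HasWord g.1.1.1 (LWord.prepend α γ) ∧ L.HasWord g.2.2.1.1 (LWord.prepend β γ) ∧
    g.2.1 = (α.length : ℤ) - (β.length : ℤ) ∧
    L.cut α γ g.1.1.1 = L.cut β γ g.2.2.1.1}

theorem isTriple_letter (a : 𝓐) : L.IsTriple [a] (L.range [a]) [a] :=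
  have h : L.IsLabelledPath [a] := L.isLabelledPath_of_nonempty (L.range_singleton_nonempty a)
  have hm : L.range [a] ∈ L.setsOf [a] := ⟨L.range_mem _ h (List.cons_ne_nil _ _), subset_rfl⟩
  ⟨h, h, hm, hm, L.range_singleton_nonempty a⟩

theorem isTriple_nil (a : 𝓐) : L.IsTriple [] (L.range [a]) [] :=
  have hm : L.range [a] ∈ L.setsOf [] :=
    ⟨(L.isTriple_letter a).mem_left.1, (Set.subset_univ _).trans (L.relRange_nil Set.univ).superset⟩
  ⟨L.isLabelledPath_nil, L.isLabelledPath_nil, hm, hm, L.range_singleton_nonempty a⟩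

/-- The idempotent `(a, r(a), a)`. -/
def letterIdem (a : 𝓐) : L.S := S.triple [a] (L.range [a]) [a] (L.isTriple_letter a)

/-- The idempotent `(ε, r(a), ε)`, where `ε` is the empty word. -/
def rangeIdem (a : 𝓐) : L.S := S.triple [] (L.range [a]) [] (L.isTriple_nil a)

end LabelledSpace

/-- A map defined on a subset `U` of `X`, as a partially defined map. -/
def PartialMap.ofFun {X : Type*} (U : Set X) (σ : U → X) : X →. X :=
  fun x => ⟨x ∈ U, fun h => σ ⟨x, h⟩⟩

/-- The powers of a partially defined map. -/
def PartialMap.pow {X : Type*} (σ : X →. X) : ℕ → (X →. X)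
  | 0 => PFun.id X
  | n + 1 => (PartialMap.pow σ n).comp σ

/-- The Renault–Deaconu groupoid, as a set, of a map `σ : U → X` defined on a subset `U` of `X`:
all `(x, m - n, y)` with `x ∈ dom (σ^m)`, `y ∈ dom (σ^n)` and `σ^m x = σ^n y`. -/
def renaultDeaconu {X : Type*} (U : Set X) (σ : U → X) : Set (X × ℤ × X) :=
  {g | ∃ (m n : ℕ)
    (hx : (PartialMap.pow (PartialMap.ofFun U σ) m g.1).Dom)
    (hy : (PartialMap.pow (PartialMap.ofFun U σ) n g.2.2).Dom),
    g.2.1 = (m : ℤ) - (n : ℤ) ∧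
    (PartialMap.pow (PartialMap.ofFun U σ) m g.1).get hx =
      (PartialMap.pow (PartialMap.ofFun U σ) n g.2.2).get hy}

/-! A filter `ξ` is determined by its components `comp ξ β`, and `IsFilterFamily` says which
families of sets arise in this way: the words with nonempty component are comparable, components are
compatible with `A ↦ r(A, γ) ∩ B`, and `A ⊆ r(B, γ)` pulls membership back to the shorter word. All
filter arguments are made on such families.

Removing a first letter `a` sends a family `F` to the sets `C ∈ B_β` with `C ∩ r(aβ) ∈ F(aβ)`
(`shiftFamily`). Its inverse (`unshiftFamily`) puts at `ε` the `C` with `r(C, a) ∈ G(ε)` and at `aβ`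
the members of `G(β)` inside `r(aβ)`. Weak left-resolution is what makes both results filters. Each
membership on one side amounts to a fixed condition and a single membership on the other, so this is
a homeomorphism between the clopen sets of filters containing `(a, r(a), a)` and `(ε, r(a), ε)`
(`shiftHomeomorph`).

Tightness needs no description by covers. The homeomorphism and its inverse preserve inclusion and
both sets of filters are closed under enlargement, so ultrafilters correspond; both sets are open,
so closure points of ultrafilters correspond too (`shiftHomeomorph_mem_tightSet`). As a filter has
at most one first letter, the homeomorphisms glue to `tightShift` on the disjoint open sets `V_{(a,
r(a), a)}`, whose union is the domain of `σ`.

For the groupoid, `cut_tightShift` shows that cutting letters one at a time agrees with cutting a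
word at once. Hence `σ^{|α|}(ξ) = H_{[α]γ}(ξ)`, with associated word `γ`, and both descriptions of
`Γ` coincide. -/

namespace LabelledGraph

variable {V E 𝓐 : Type*} (G : LabelledGraph V E 𝓐)

/-! ### Ranges along concatenated words. -/

theorem IsPath.exists_of_append {u w : V} {p q : List E} (h : G.IsPath u (p ++ q) w) :
    ∃ v, G.IsPath u p v ∧ G.IsPath v q w := by
  induction p generalizing u with
  | nil => exact ⟨u, IsPath.nil u, h⟩
  | cons e p ih =>
    cases h with
    | cons _ h =>
      obtain ⟨v, hp, hq⟩ := ih h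
      exact ⟨v, IsPath.cons e hp, hq⟩

theorem relRange_append (A : Set V) (α β : List 𝓐) :
    G.relRange A (α ++ β) = G.relRange (G.relRange A α) β := by
  ext w
  constructor
  · rintro ⟨u, hu, p, hp, hl⟩
    obtain ⟨p, q, rfl, rfl, rfl⟩ := List.map_eq_append_iff.1 hl
    obtain ⟨v, hp, hq⟩ := hp.exists_of_append
    exact ⟨v, ⟨u, hu, p, hp, rfl⟩, q, hq, rfl⟩
  · rintro ⟨v, ⟨u, hu, p, hp, rfl⟩, q, hq, rfl⟩
    exact ⟨u, hu, p ++ q, hp.append G hq, List.map_append⟩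

theorem relRange_cons (A : Set V) (a : 𝓐) (β : List 𝓐) :
    G.relRange A (a :: β) = G.relRange (G.relRange A [a]) β :=
  G.relRange_append A [a] β

theorem range_append (α β : List 𝓐) :
    G.range (α ++ β) = G.relRange (G.range α) β :=
  G.relRange_append _ α β

theorem range_cons (a : 𝓐) (β : List 𝓐) :
    G.range (a :: β) = G.relRange (G.range [a]) β :=
  G.range_append [a] β

theorem range_append_subset (α β : List 𝓐) : G.range (α ++ β) ⊆ G.range β := by
  rw [range_append]
  exact G.relRange_mono (Set.subset_univ _) β

theorem range_cons_subset (a : 𝓐) (β : List 𝓐) : G.range (a :: β) ⊆ G.range β :=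
  G.range_append_subset [a] β

theorem relRange_subset_range (A : Set V) (α : List 𝓐) : G.relRange A α ⊆ G.range α :=
  G.relRange_mono (Set.subset_univ _) α

theorem isLabelledPath_iff {α : List 𝓐} : G.IsLabelledPath α ↔ (G.range α).Nonempty := by
  constructor
  · rintro ⟨v, p, w, hp, hl⟩
    exact ⟨w, v, Set.mem_univ v, p, hp, hl⟩
  · exact G.isLabelledPath_of_nonempty

theorem range_nil : G.range [] = Set.univ := G.relRange_nil _

theorem nonempty_of_relRange {A : Set V} {α : List 𝓐} (h : (G.relRange A α).Nonempty) :
    A.Nonempty := by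
  obtain ⟨_, v, hv, _⟩ := h
  exact ⟨v, hv⟩

theorem isLabelledPath_of_append_left {α β : List 𝓐} (h : G.IsLabelledPath (α ++ β)) :
    G.IsLabelledPath α := by
  rw [isLabelledPath_iff, range_append] at h
  exact G.isLabelledPath_iff.2 (G.nonempty_of_relRange h)

theorem isLabelledPath_of_append_right {α β : List 𝓐} (h : G.IsLabelledPath (α ++ β)) :
    G.IsLabelledPath β := by
  rw [isLabelledPath_iff] at h ⊢
  exact h.mono (G.range_append_subset α β)

end LabelledGraph

/-! ### Products in `S`, and filters as families of sets. -/

namespace LabelledSpace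

variable {V E 𝓐 : Type*} {L : LabelledSpace V E 𝓐}

/-- The two remaining cases are trivial: the empty word changes nothing, and a word that labels no
path has empty relative ranges. -/
theorem IsWeaklyLeftResolving.relRange_inter (hL : L.IsWeaklyLeftResolving) {A B : Set V}
    (hA : A ∈ L.sets) (hB : B ∈ L.sets) (α : List 𝓐) :
    L.relRange (A ∩ B) α = L.relRange A α ∩ L.relRange B α := by
  by_cases hα : L.IsLabelledPath α
  · obtain rfl | hne := eq_or_ne α []
    · simp only [L.relRange_nil]
    · exact hL A hA B hB α hα hne
  · have h (C : Set V) : L.relRange C α = ∅ := by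
      by_contra h
      exact hα (L.isLabelledPath_of_nonempty (Set.nonempty_iff_ne_empty.2 h))
    simp only [h, Set.inter_self]

theorem isTriple_iff {α : List 𝓐} {A : Set V} :
    L.IsTriple α A α ↔ A ∈ L.sets ∧ A ⊆ L.range α ∧ A.Nonempty :=
  ⟨fun h => ⟨h.mem_left.1, h.mem_left.2, h.nonempty⟩, fun h =>
    have hα := L.isLabelledPath_of_nonempty (h.2.2.mono h.2.1)
    ⟨hα, hα, ⟨h.1, h.2.1⟩, ⟨h.1, h.2.1⟩, h.2.2⟩⟩

theorem isTriple_range {α : List 𝓐} (h : L.IsLabelledPath α) (hne : α ≠ []) :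
    L.IsTriple α (L.range α) α :=
  isTriple_iff.2 ⟨L.range_mem α h hne, subset_rfl, L.isLabelledPath_iff.1 h⟩

theorem S.triple_mul_of_append {α β γ δ ε : List 𝓐} {A B : Set V} {hA : L.IsTriple α A β}
    {hB : L.IsTriple γ B δ} (hγ : γ = β ++ ε) (hne : (L.relRange A ε ∩ B).Nonempty) :
    ∃ h, S.triple α A β hA * S.triple γ B δ hB = S.triple (α ++ ε) (L.relRange A ε ∩ B) δ h := by
  subst hγ
  refine ⟨hA.mul hB hne, ?_⟩
  have h : ∃ γ', β ++ ε = β ++ γ' ∧ (L.relRange A γ' ∩ B).Nonempty := ⟨ε, rfl, hne⟩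
  have hc : h.choose = ε := (List.append_cancel_left h.choose_spec.1).symm
  change S.mul _ _ = _
  rw [S.mul, dif_pos h, S.triple.injEq, hc]
  exact ⟨rfl, rfl, rfl⟩

theorem S.triple_mul_of_append' {α β γ δ ε : List 𝓐} {A B : Set V} {hA : L.IsTriple α A β}
    {hB : L.IsTriple γ B δ} (hβ : β = γ ++ ε) (hne : (A ∩ L.relRange B ε).Nonempty) :
    ∃ h, S.triple α A β hA * S.triple γ B δ hB = S.triple α (A ∩ L.relRange B ε) (δ ++ ε) h := by
  subst hβ
  -- For `ε = []` the definition of the product takes its first branch, so the result has to be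
  -- rewritten; for `ε ≠ []` that branch is excluded by length.
  obtain rfl | hε := eq_or_ne ε []
  · rw [L.relRange_nil] at hne
    obtain ⟨h, h'⟩ := S.triple_mul_of_append (hA := hA) (hB := hB) (ε := []) (by simp)
      (by rwa [L.relRange_nil])
    have key : S.triple (α ++ []) (L.relRange A [] ∩ B) δ h = S.triple α (A ∩ L.relRange B [])
        (δ ++ []) (by simpa [L.relRange_nil] using h) := by
      rw [S.triple.injEq]
      simp [L.relRange_nil]
    exact ⟨_, h'.trans key⟩
  · refine ⟨hA.mul' hB hne, ?_⟩
    have h0 : ¬∃ γ', γ = (γ ++ ε) ++ γ' ∧ (L.relRange A γ' ∩ B).Nonempty := by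
      rintro ⟨γ', h, -⟩
      have := congrArg List.length h
      simp only [List.length_append] at this
      exact hε (List.length_eq_zero_iff.1 (by omega))
    have h : ∃ β', γ ++ ε = γ ++ β' ∧ (A ∩ L.relRange B β').Nonempty := ⟨ε, rfl, hne⟩
    have hc : h.choose = ε := (List.append_cancel_left h.choose_spec.1).symm
    change S.mul _ _ = _
    rw [S.mul, dif_neg h0, dif_pos h, S.triple.injEq, hc]
    exact ⟨rfl, rfl, rfl⟩

theorem S.exists_of_triple_mul_ne_zero {α β γ δ : List 𝓐} {A B : Set V} {hA : L.IsTriple α A β}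
    {hB : L.IsTriple γ B δ} (h : S.triple α A β hA * S.triple γ B δ hB ≠ 0) :
    (∃ ε, γ = β ++ ε ∧ (L.relRange A ε ∩ B).Nonempty) ∨
      ∃ ε, β = γ ++ ε ∧ (A ∩ L.relRange B ε).Nonempty := by
  by_contra! hc
  apply h
  change S.mul _ _ = _
  rw [S.mul, dif_neg, dif_neg]
  · rfl
  · rintro ⟨ε, h1, h2⟩
    exact h2.ne_empty (hc.2 ε h1)
  · rintro ⟨ε, h1, h2⟩
    exact h2.ne_empty (hc.1 ε h1)

variable (L) in
/-- The properties of the families of sets `comp ξ` with `ξ` a filter. -/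
structure IsFilterFamily (F : List 𝓐 → Set (Set V)) : Prop where
  isTriple : ∀ {α A}, A ∈ F α → L.IsTriple α A α
  nonempty : ∃ α, (F α).Nonempty
  comparable : ∀ {α β}, (F α).Nonempty → (F β).Nonempty → (∃ γ, β = α ++ γ) ∨ ∃ γ, α = β ++ γ
  relRange_inter_mem : ∀ {α γ A B}, A ∈ F α → B ∈ F (α ++ γ) → L.relRange A γ ∩ B ∈ F (α ++ γ)
  mem_of_subset : ∀ {β γ A B}, A ∈ F (β ++ γ) → L.IsTriple β B β → A ⊆ L.relRange B γ → B ∈ F β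

namespace IsFilterFamily

variable {F : List 𝓐 → Set (Set V)} (hF : L.IsFilterFamily F)
include hF

theorem mem_of_superset {α : List 𝓐} {A B : Set V} (hA : A ∈ F α) (hB : B ∈ L.sets)
    (hBα : B ⊆ L.range α) (h : A ⊆ B) : B ∈ F α := by
  refine hF.mem_of_subset (γ := []) (by rwa [List.append_nil])
    (isTriple_iff.2 ⟨hB, hBα, (hF.isTriple hA).nonempty.mono h⟩) ?_
  rwa [L.relRange_nil]

theorem inter_mem {α : List 𝓐} {A B : Set V} (hA : A ∈ F α) (hB : B ∈ F α) : A ∩ B ∈ F α := by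
  have := hF.relRange_inter_mem (γ := []) hA (by rwa [List.append_nil])
  rwa [List.append_nil, L.relRange_nil] at this

/-- The empty word is excluded because the whole vertex set need not belong to the family. -/
theorem range_mem {α β : List 𝓐} (h : (F (α ++ β)).Nonempty) (hα : α ≠ []) :
    L.range α ∈ F α := by
  obtain ⟨A, hA⟩ := h
  have ht := hF.isTriple hA
  refine hF.mem_of_subset hA (isTriple_range (L.isLabelledPath_of_append_left ht.left) hα) ?_
  rw [← L.range_append]
  exact ht.mem_left.2

end IsFilterFamily

theorem mem_comp {ξ : Set L.S} {α : List 𝓐} {A : Set V} (h : L.IsTriple α A α) :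
    A ∈ L.comp ξ α ↔ S.triple α A α h ∈ ξ :=
  ⟨fun h => h.2, fun h' => ⟨h, h'⟩⟩

/-- Two elements of a filter have nonzero product, which forces their words to be comparable and the
middle set to be nonempty. The order relation `(α, A, α) ≤ (β, B, β)` becomes `α = βγ` and `A ⊆ r(B,
γ)`. -/
theorem IsFilter.isFilterFamily {ξ : Set L.S} (hξ : L.IsFilter ξ) :
    L.IsFilterFamily (L.comp ξ) where
  isTriple h := h.1
  nonempty := by
    obtain ⟨e, he⟩ := hξ.nonempty
    obtain rfl | ⟨α, A, h, rfl⟩ := hξ.subset he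
    · exact absurd he hξ.zero_notMem
    · exact ⟨α, A, h, he⟩
  comparable := by
    rintro α β ⟨A, hA, hAξ⟩ ⟨B, hB, hBξ⟩
    obtain ⟨ε, h, -⟩ | ⟨ε, h, -⟩ := S.exists_of_triple_mul_ne_zero
      (ne_of_mem_of_not_mem (hξ.mul_mem _ hAξ _ hBξ) hξ.zero_notMem)
    · exact Or.inl ⟨ε, h⟩
    · exact Or.inr ⟨ε, h⟩
  relRange_inter_mem := by
    rintro α γ A B ⟨hA, hAξ⟩ ⟨hB, hBξ⟩
    have hmem := hξ.mul_mem _ hAξ _ hBξ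
    have hne : (L.relRange A γ ∩ B).Nonempty := by
      obtain ⟨ε, h, h'⟩ | ⟨ε, h, h'⟩ := S.exists_of_triple_mul_ne_zero
        (ne_of_mem_of_not_mem hmem hξ.zero_notMem)
      · rwa [List.append_cancel_left h]
      · have := congrArg List.length h
        simp only [List.length_append] at this
        obtain rfl : γ = [] := List.length_eq_zero_iff.1 (by omega)
        obtain rfl : ε = [] := List.length_eq_zero_iff.1 (by omega)
        simpa only [L.relRange_nil] using h'
    obtain ⟨h, h'⟩ := S.triple_mul_of_append (hA := hA) (hB := hB) rfl hne
    exact ⟨h, h' ▸ hmem⟩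
  mem_of_subset := by
    rintro β γ A B ⟨hA, hAξ⟩ hB hsub
    have hi : A ∩ L.relRange B γ = A := Set.inter_eq_left.2 hsub
    obtain ⟨h, h'⟩ := S.triple_mul_of_append' (hA := hA) (hB := hB) rfl
      (hi.symm ▸ hA.nonempty)
    refine ⟨hB, hξ.mem_of_le _ hAξ _ (Or.inr ⟨β, B, hB, rfl⟩) (h'.trans ?_)⟩
    rw [S.triple.injEq]
    exact ⟨rfl, hi, rfl⟩

variable (L) in
/-- The set of idempotents that corresponds to a family of sets. -/
def ofFamily (F : List 𝓐 → Set (Set V)) : Set L.S :=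
  {e | ∃ α A h, A ∈ F α ∧ e = S.triple α A α h}

theorem triple_mem_ofFamily {F : List 𝓐 → Set (Set V)} {α : List 𝓐} {A : Set V}
    {h : L.IsTriple α A α} : S.triple α A α h ∈ L.ofFamily F ↔ A ∈ F α := by
  constructor
  · rintro ⟨β, B, hB, hBF, heq⟩
    rw [S.triple.injEq] at heq
    obtain ⟨rfl, rfl, -⟩ := heq
    exact hBF
  · exact fun hA => ⟨α, A, h, hA, rfl⟩

theorem IsFilterFamily.comp_ofFamily {F : List 𝓐 → Set (Set V)} (hF : L.IsFilterFamily F) :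
    L.comp (L.ofFamily F) = F := by
  ext α A
  exact ⟨fun h => triple_mem_ofFamily.1 h.2, fun h => ⟨hF.isTriple h, triple_mem_ofFamily.2 h⟩⟩

theorem IsFilter.ofFamily_comp {ξ : Set L.S} (hξ : L.IsFilter ξ) :
    L.ofFamily (L.comp ξ) = ξ := by
  ext e
  constructor
  · rintro ⟨α, A, h, hA, rfl⟩
    exact hA.2
  · intro he
    obtain rfl | ⟨α, A, h, rfl⟩ := hξ.subset he
    · exact absurd he hξ.zero_notMem
    · exact ⟨α, A, h, ⟨h, he⟩, rfl⟩

theorem IsFilter.subset_iff {ξ η : Set L.S} (hξ : L.IsFilter ξ) :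
    ξ ⊆ η ↔ ∀ α, L.comp ξ α ⊆ L.comp η α := by
  constructor
  · rintro h α A ⟨hA, hAξ⟩
    exact ⟨hA, h hAξ⟩
  · intro h e he
    obtain rfl | ⟨α, A, hA, rfl⟩ := hξ.subset he
    · exact absurd he hξ.zero_notMem
    · exact (h α ⟨hA, he⟩).2

theorem IsFilter.eq_of_comp_eq {ξ η : Set L.S} (hξ : L.IsFilter ξ) (hη : L.IsFilter η)
    (h : L.comp ξ = L.comp η) : ξ = η := by
  rw [← hξ.ofFamily_comp, ← hη.ofFamily_comp, h]

theorem IsFilterFamily.isFilter {F : List 𝓐 → Set (Set V)} (hF : L.IsFilterFamily F) :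
    L.IsFilter (L.ofFamily F) where
  subset := by
    rintro e ⟨α, A, h, -, rfl⟩
    exact Or.inr ⟨α, A, h, rfl⟩
  nonempty := by
    obtain ⟨α, A, hA⟩ := hF.nonempty
    exact ⟨_, α, A, hF.isTriple hA, hA, rfl⟩
  zero_notMem := by
    rintro ⟨α, A, h, -, h'⟩
    cases h'
  mul_mem := by
    rintro _ ⟨α, A, hA, hAF, rfl⟩ _ ⟨β, B, hB, hBF, rfl⟩
    obtain ⟨γ, rfl⟩ | ⟨γ, rfl⟩ := hF.comparable ⟨A, hAF⟩ ⟨B, hBF⟩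
    · have hm := hF.relRange_inter_mem hAF hBF
      obtain ⟨h, h'⟩ := S.triple_mul_of_append (hA := hA) (hB := hB) rfl (hF.isTriple hm).nonempty
      rw [h']
      exact triple_mem_ofFamily.2 hm
    · have hm := hF.relRange_inter_mem hBF hAF
      rw [Set.inter_comm] at hm
      obtain ⟨h, h'⟩ := S.triple_mul_of_append' (hA := hA) (hB := hB) rfl (hF.isTriple hm).nonempty
      rw [h']
      exact triple_mem_ofFamily.2 hm
  mem_of_le := by
    rintro _ ⟨α, A, hA, hAF, rfl⟩ _ (rfl | ⟨β, B, hB, rfl⟩) hle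
    · cases hle
    · refine triple_mem_ofFamily.2 ?_
      have hne : S.triple α A α hA * S.triple β B β hB ≠ 0 := by
        rw [hle]
        rintro ⟨⟩
      obtain ⟨ε, rfl, h'⟩ | ⟨ε, rfl, h'⟩ := S.exists_of_triple_mul_ne_zero hne
      · obtain ⟨h1, h2⟩ := S.triple_mul_of_append (hA := hA) (hB := hB) rfl h'
        rw [hle, S.triple.injEq] at h2
        -- The product has word `αε` and equals an element with word `α`, so `ε` is empty.
        obtain ⟨h3, h4, -⟩ := h2
        obtain rfl : ε = [] := List.append_right_eq_self.1 h3.symm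
        rw [L.relRange_nil] at h4
        rw [List.append_nil] at hB ⊢
        exact hF.mem_of_superset hAF hB.mem_left.1 hB.mem_left.2 (Set.inter_eq_left.1 h4.symm)
      · obtain ⟨h1, h2⟩ := S.triple_mul_of_append' (hA := hA) (hB := hB) rfl h'
        rw [hle, S.triple.injEq] at h2
        exact hF.mem_of_subset hAF hB (Set.inter_eq_left.1 h2.2.1.symm)

end LabelledSpace

/-! ### Removing and adding a first letter; ultrafilters and tight filters. -/

namespace LabelledSpace

variable {V E 𝓐 : Type*} {L : LabelledSpace V E 𝓐}

variable (L) in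
/-- The family of sets obtained by removing the first letter `a`. -/
def shiftFamily (a : 𝓐) (F : List 𝓐 → Set (Set V)) (β : List 𝓐) : Set (Set V) :=
  {C | C ∈ L.setsOf β ∧ C ∩ L.range (a :: β) ∈ F (a :: β)}

variable (L) in
/-- The family of sets obtained by adding the first letter `a`. -/
def unshiftFamily (a : 𝓐) (G : List 𝓐 → Set (Set V)) : List 𝓐 → Set (Set V)
  | [] => {C | C ∈ L.sets ∧ L.relRange C [a] ∈ G []}
  | b :: β => {C | b = a ∧ C ⊆ L.range (a :: β) ∧ C ∈ G β}

theorem IsFilterFamily.shiftFamily (hL : L.IsWeaklyLeftResolving) {a : 𝓐}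
    {F : List 𝓐 → Set (Set V)} (hF : L.IsFilterFamily F) (ha : L.range [a] ∈ F [a]) :
    L.IsFilterFamily (L.shiftFamily a F) where
  isTriple h := isTriple_iff.2 ⟨h.1.1, h.1.2, (hF.isTriple h.2).nonempty.mono Set.inter_subset_left⟩
  nonempty := by
    -- The component at the empty word is never empty after a shift: it contains `r(a)`.
    refine ⟨[], L.range [a], (L.isTriple_nil a).mem_left, ?_⟩
    rwa [Set.inter_self]
  comparable := by
    rintro α β ⟨A, hA⟩ ⟨B, hB⟩
    refine (hF.comparable ⟨_, hA.2⟩ ⟨_, hB.2⟩).imp ?_ ?_ <;>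
    · rintro ⟨γ, h⟩
      exact ⟨γ, (List.cons.inj h).2⟩
  relRange_inter_mem := by
    rintro α γ A B hA hB
    have h1 := hF.relRange_inter_mem (γ := γ) hA.2 hB.2
    have hγ : L.IsLabelledPath γ :=
      L.isLabelledPath_of_append_right (α := a :: α) (hF.isTriple h1).left
    have h2 : L.relRange A γ ∩ B ∈ L.sets := L.inter_mem _ (L.relRange_mem A hA.1.1 γ hγ) _ hB.1.1
    refine ⟨⟨h2, Set.inter_subset_right.trans hB.1.2⟩, ?_⟩
    have hr := (isTriple_range (hF.isTriple hB.2).left (List.cons_ne_nil _ _)).mem_left.1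
    refine hF.mem_of_superset h1 (L.inter_mem _ h2 _ hr) Set.inter_subset_right ?_
    rw [← Set.inter_assoc]
    exact Set.inter_subset_inter_left _
      (Set.inter_subset_inter_left _ (L.relRange_mono Set.inter_subset_left γ))
  mem_of_subset := by
    rintro β γ A B hA hB hsub
    have ht := hF.isTriple hA.2
    have hr : L.range (a :: β) ∈ L.sets :=
      (isTriple_range (L.isLabelledPath_of_append_left (α := a :: β) ht.left)
        (List.cons_ne_nil _ _)).mem_left.1
    -- Weak left-resolution gives `r(B ∩ r(aβ), γ) = r(B, γ) ∩ r(aβγ)`, so the inclusion survives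
    -- intersection with the ranges.
    have hi : A ∩ L.range (a :: (β ++ γ)) ⊆ L.relRange (B ∩ L.range (a :: β)) γ := by
      rw [hL.relRange_inter hB.mem_left.1 hr, ← L.range_append]
      exact Set.inter_subset_inter_left _ hsub
    exact ⟨hB.mem_left, hF.mem_of_subset (β := a :: β) hA.2
      (isTriple_iff.2 ⟨L.inter_mem _ hB.mem_left.1 _ hr, Set.inter_subset_right,
        L.nonempty_of_relRange (ht.nonempty.mono hi)⟩) hi⟩

theorem IsFilterFamily.unshiftFamily (hL : L.IsWeaklyLeftResolving) {a : 𝓐}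
    {G : List 𝓐 → Set (Set V)} (hG : L.IsFilterFamily G) (ha : L.range [a] ∈ G []) :
    L.IsFilterFamily (L.unshiftFamily a G) where
  isTriple {α A} hA := by
    cases α with
    | nil =>
      refine isTriple_iff.2 ⟨hA.1, ?_, L.nonempty_of_relRange (hG.isTriple hA.2).nonempty⟩
      rw [L.range_nil]
      exact Set.subset_univ A
    | cons b β =>
      obtain ⟨rfl, h1, h2⟩ := hA
      exact isTriple_iff.2 ⟨(hG.isTriple h2).mem_left.1, h1, (hG.isTriple h2).nonempty⟩
  nonempty := ⟨[a], L.range [a], rfl, subset_rfl, ha⟩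
  comparable {α β} := by
    rintro ⟨A, hA⟩ ⟨B, hB⟩
    cases α with
    | nil => exact Or.inl ⟨β, rfl⟩
    | cons b α =>
      cases β with
      | nil => exact Or.inr ⟨b :: α, rfl⟩
      | cons c β =>
        obtain ⟨rfl, -, hA⟩ := hA
        obtain ⟨rfl, -, hB⟩ := hB
        refine (hG.comparable ⟨_, hA⟩ ⟨_, hB⟩).imp ?_ ?_ <;>
        · rintro ⟨γ, rfl⟩
          exact ⟨γ, rfl⟩
  relRange_inter_mem {α γ A B} hA hB := by
    cases α with
    | nil =>
      cases γ with
      | nil =>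
        change L.relRange A [] ∩ B ∈ L.sets ∧ L.relRange (L.relRange A [] ∩ B) [a] ∈ G []
        -- Without weak left-resolution the sets `C` with `r(C, a) ∈ G []` might not be closed under
        -- intersection.
        rw [L.relRange_nil, hL.relRange_inter hA.1 hB.1]
        exact ⟨L.inter_mem _ hA.1 _ hB.1, hG.inter_mem hA.2 hB.2⟩
      | cons b γ =>
        obtain ⟨rfl, h1, h2⟩ := hB
        refine ⟨rfl, Set.inter_subset_right.trans h1, ?_⟩
        rw [L.relRange_cons]
        exact hG.relRange_inter_mem (α := []) hA.2 h2
    | cons b α =>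
      obtain ⟨rfl, h1, h2⟩ := hA
      obtain ⟨-, h3, h4⟩ := hB
      exact ⟨rfl, Set.inter_subset_right.trans h3, hG.relRange_inter_mem h2 h4⟩
  mem_of_subset {β γ A B} hA hB hsub := by
    cases β with
    | nil =>
      refine ⟨hB.mem_left.1, ?_⟩
      have hBa : L.relRange B [a] ∈ L.sets :=
        L.relRange_mem B hB.mem_left.1 _ (L.isTriple_letter a).left
      have hBr : L.relRange B [a] ⊆ L.range [] := by
        rw [L.range_nil]
        exact Set.subset_univ _
      cases γ with
      | nil =>
        refine hG.mem_of_superset hA.2 hBa hBr (L.relRange_mono ?_ [a])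
        rwa [L.relRange_nil] at hsub
      | cons b γ =>
        obtain ⟨rfl, h1, h2⟩ := hA
        rw [L.relRange_cons] at hsub
        exact hG.mem_of_subset (β := []) h2 (isTriple_iff.2 ⟨hBa, hBr,
          L.nonempty_of_relRange ((hG.isTriple h2).nonempty.mono hsub)⟩) hsub
    | cons b β =>
      obtain ⟨rfl, h1, h2⟩ := hA
      have hr : B ⊆ L.range β := hB.mem_left.2.trans (L.range_cons_subset b β)
      exact ⟨rfl, hB.mem_left.2,
        hG.mem_of_subset h2 (isTriple_iff.2 ⟨hB.mem_left.1, hr, hB.nonempty⟩) hsub⟩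

/-- At the empty word, `C ∈ F []` is equivalent to `r(C, a) ∈ F [a]`. At a nonempty word,
comparability with `[a]` forces the first letter to be `a`. -/
theorem IsFilterFamily.unshiftFamily_shiftFamily {a : 𝓐} {F : List 𝓐 → Set (Set V)}
    (hF : L.IsFilterFamily F) (ha : L.range [a] ∈ F [a]) :
    L.unshiftFamily a (L.shiftFamily a F) = F := by
  ext α C
  cases α with
  | nil =>
    have hr : L.relRange C [a] ∩ L.range [a] = L.relRange C [a] :=
      Set.inter_eq_left.2 (L.relRange_subset_range C [a])
    constructor
    · rintro ⟨h1, -, h2⟩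
      rw [hr] at h2
      refine hF.mem_of_subset (β := []) h2 (isTriple_iff.2 ⟨h1, ?_,
        L.nonempty_of_relRange (hF.isTriple h2).nonempty⟩) subset_rfl
      rw [L.range_nil]
      exact Set.subset_univ _
    · intro h
      have hs := (hF.isTriple h).mem_left.1
      refine ⟨hs, ⟨L.relRange_mem _ hs _ (L.isTriple_letter a).left, ?_⟩,
        hF.relRange_inter_mem (α := []) h ha⟩
      rw [L.range_nil]
      exact Set.subset_univ _
  | cons b β =>
    constructor
    · rintro ⟨rfl, h1, -, h2⟩
      rwa [Set.inter_eq_left.2 h1] at h2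
    · intro h
      have hba : b = a := by
        obtain ⟨γ, h'⟩ | ⟨γ, h'⟩ := hF.comparable ⟨_, h⟩ ⟨_, ha⟩ <;>
        · simp only [List.cons_append, List.cons.injEq] at h'
          simp [h'.1]
      subst hba
      have ht := hF.isTriple h
      refine ⟨rfl, ht.mem_left.2, ⟨ht.mem_left.1,
        ht.mem_left.2.trans (L.range_cons_subset b β)⟩, ?_⟩
      rwa [Set.inter_eq_left.2 ht.mem_left.2]

/-- Since `r(a) ∈ G []` and `r(aβ) = r(r(a), β)`, intersecting a member of `G β` with `r(aβ)` stays
in `G β`. -/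
theorem IsFilterFamily.shiftFamily_unshiftFamily {a : 𝓐} {G : List 𝓐 → Set (Set V)}
    (hG : L.IsFilterFamily G) (ha : L.range [a] ∈ G []) :
    L.shiftFamily a (L.unshiftFamily a G) = G := by
  ext β C
  constructor
  · rintro ⟨h1, -, -, h2⟩
    exact hG.mem_of_superset h2 h1.1 h1.2 Set.inter_subset_left
  · intro h
    refine ⟨(hG.isTriple h).mem_left, rfl, Set.inter_subset_right, ?_⟩
    rw [Set.inter_comm, L.range_cons]
    exact hG.relRange_inter_mem (α := []) ha h

theorem shiftFamily_mono (a : 𝓐) {F F' : List 𝓐 → Set (Set V)} (h : ∀ α, F α ⊆ F' α)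
    (β : List 𝓐) : L.shiftFamily a F β ⊆ L.shiftFamily a F' β :=
  fun _ hC => ⟨hC.1, h _ hC.2⟩

theorem unshiftFamily_mono (a : 𝓐) {G G' : List 𝓐 → Set (Set V)} (h : ∀ α, G α ⊆ G' α) :
    ∀ β, L.unshiftFamily a G β ⊆ L.unshiftFamily a G' β
  | [] => fun _ hC => ⟨hC.1, h _ hC.2⟩
  | _ :: _ => fun _ hC => ⟨hC.1, hC.2.1, h _ hC.2.2⟩

theorem Filt.isFilterFamily (ξ : L.Filt) : L.IsFilterFamily (L.comp ξ.1) := ξ.2.isFilterFamily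

/-- The filter of a family of sets. -/
def IsFilterFamily.toFilt {F : List 𝓐 → Set (Set V)} (hF : L.IsFilterFamily F) : L.Filt :=
  ⟨L.ofFamily F, hF.isFilter⟩

theorem IsFilterFamily.comp_toFilt {F : List 𝓐 → Set (Set V)} (hF : L.IsFilterFamily F) :
    L.comp hF.toFilt.1 = F := hF.comp_ofFamily

theorem Filt.eq_of_comp_eq {ξ η : L.Filt} (h : L.comp ξ.1 = L.comp η.1) : ξ = η :=
  Subtype.ext (ξ.2.eq_of_comp_eq η.2 h)

theorem Filt.subset_iff {ξ η : L.Filt} : ξ.1 ⊆ η.1 ↔ ∀ α, L.comp ξ.1 α ⊆ L.comp η.1 α :=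
  ξ.2.subset_iff

theorem isClopen_mem_idem (e : L.idem) : IsClopen {ξ : L.Filt | e.1 ∈ ξ.1} := by
  have h : Continuous fun ξ : L.Filt => Filt.char L ξ e :=
    continuous_pi_iff.1 (continuous_induced_dom (f := Filt.char L)) e
  convert (isClopen_discrete {true}).preimage h using 1
  ext ξ
  simp [Filt.char]

theorem isClopen_mem_comp (α : List 𝓐) (A : Set V) :
    IsClopen {ξ : L.Filt | A ∈ L.comp ξ.1 α} := by
  by_cases h : L.IsTriple α A α
  · simp only [mem_comp h]
    exact isClopen_mem_idem ⟨_, Or.inr ⟨α, A, h, rfl⟩⟩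
  · convert isClopen_empty
    ext ξ
    exact iff_of_false (fun h' => h h'.1) id

theorem _root_.isClopen_setOf_const {X : Type*} [TopologicalSpace X] (p : Prop) :
    IsClopen {_x : X | p} :=
  ⟨isClosed_const, isOpen_const⟩

/-- Characters take values in a discrete two-point space, so continuity is clopenness of each
membership condition; at `0` the character is constantly false. -/
theorem continuous_toFilt_of_isClopen {X : Type*} [TopologicalSpace X] {f : X → L.Filt}
    (h : ∀ α A, IsClopen {x | A ∈ L.comp (f x).1 α}) : Continuous f := by
  refine continuous_induced_rng.2 (continuous_pi ?_)
  rintro ⟨_, rfl | ⟨α, A, hA, rfl⟩⟩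
  · refine (continuous_const (y := false)).congr fun x => ?_
    simp [Filt.char, (f x).2.zero_notMem]
  · refine (IsLocallyConstant.iff_continuous _).1 (IsLocallyConstant.iff_isOpen_fiber.2 ?_)
    have hc := h α A
    simp only [mem_comp hA] at hc
    rintro (_ | _)
    · convert hc.compl.isOpen using 1
      ext x
      simp [Filt.char]
    · convert hc.isOpen using 1
      ext x
      simp [Filt.char]

variable (L) in
/-- The filters that contain `(a, r(a), a)`. -/
def letterSet (a : 𝓐) : Set L.Filt := {ξ | L.range [a] ∈ L.comp ξ.1 [a]}

variable (L) in
/-- The filters that contain `(ε, r(a), ε)`. -/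
def rangeSet (a : 𝓐) : Set L.Filt := {ξ | L.range [a] ∈ L.comp ξ.1 []}

/-- Removing the first letter `a`, as a homeomorphism between sets of filters. -/
def shiftHomeomorph (hL : L.IsWeaklyLeftResolving) (a : 𝓐) : L.letterSet a ≃ₜ L.rangeSet a where
  toFun ξ := ⟨(ξ.1.isFilterFamily.shiftFamily hL ξ.2).toFilt, by
    change _ ∈ L.comp _ _
    rw [IsFilterFamily.comp_toFilt]
    refine ⟨(L.isTriple_nil a).mem_left, ?_⟩
    rw [Set.inter_self]
    exact ξ.2⟩
  invFun η := ⟨(η.1.isFilterFamily.unshiftFamily hL η.2).toFilt, by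
    change _ ∈ L.comp _ _
    rw [IsFilterFamily.comp_toFilt]
    exact ⟨rfl, subset_rfl, η.2⟩⟩
  left_inv ξ := by
    refine Subtype.ext (Filt.eq_of_comp_eq ?_)
    simp only [IsFilterFamily.comp_toFilt]
    exact ξ.1.isFilterFamily.unshiftFamily_shiftFamily ξ.2
  right_inv η := by
    refine Subtype.ext (Filt.eq_of_comp_eq ?_)
    simp only [IsFilterFamily.comp_toFilt]
    exact η.1.isFilterFamily.shiftFamily_unshiftFamily η.2
  continuous_toFun := by
    refine Continuous.subtype_mk (continuous_toFilt_of_isClopen fun β C => ?_) _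
    simp only [IsFilterFamily.comp_toFilt]
    exact (isClopen_setOf_const (C ∈ L.setsOf β)).inter
      ((isClopen_mem_comp (a :: β) (C ∩ L.range (a :: β))).preimage continuous_subtype_val)
  continuous_invFun := by
    refine Continuous.subtype_mk (continuous_toFilt_of_isClopen fun β C => ?_) _
    simp only [IsFilterFamily.comp_toFilt]
    cases β with
    | nil =>
      exact (isClopen_setOf_const (C ∈ L.sets)).inter
        ((isClopen_mem_comp [] (L.relRange C [a])).preimage continuous_subtype_val)
    | cons b β =>
      exact (isClopen_setOf_const (b = a)).inter
        ((isClopen_setOf_const (C ⊆ L.range (a :: β))).inter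
          ((isClopen_mem_comp β C).preimage continuous_subtype_val))

theorem comp_shiftHomeomorph (hL : L.IsWeaklyLeftResolving) (a : 𝓐) (ξ : L.letterSet a) :
    L.comp (shiftHomeomorph hL a ξ).1.1 = L.shiftFamily a (L.comp ξ.1.1) :=
  (ξ.1.isFilterFamily.shiftFamily hL ξ.2).comp_toFilt

theorem comp_shiftHomeomorph_symm (hL : L.IsWeaklyLeftResolving) (a : 𝓐) (η : L.rangeSet a) :
    L.comp ((shiftHomeomorph hL a).symm η).1.1 = L.unshiftFamily a (L.comp η.1.1) :=
  (η.1.isFilterFamily.unshiftFamily hL η.2).comp_toFilt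

theorem shiftHomeomorph_mono (hL : L.IsWeaklyLeftResolving) (a : 𝓐) {ξ η : L.letterSet a}
    (h : ξ.1.1 ⊆ η.1.1) :
    (shiftHomeomorph hL a ξ).1.1 ⊆ (shiftHomeomorph hL a η).1.1 := by
  rw [Filt.subset_iff] at h ⊢
  simp only [comp_shiftHomeomorph]
  exact shiftFamily_mono a h

theorem shiftHomeomorph_symm_mono (hL : L.IsWeaklyLeftResolving) (a : 𝓐) {ξ η : L.rangeSet a}
    (h : ξ.1.1 ⊆ η.1.1) :
    ((shiftHomeomorph hL a).symm ξ).1.1 ⊆ ((shiftHomeomorph hL a).symm η).1.1 := by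
  rw [Filt.subset_iff] at h ⊢
  simp only [comp_shiftHomeomorph_symm]
  exact unshiftFamily_mono a h

variable (L) in
/-- The set of ultrafilters. -/
def ultraSet : Set L.Filt := {ξ | ∀ η : L.Filt, ξ.1 ⊆ η.1 → η.1 = ξ.1}

theorem letterSet_of_subset {a : 𝓐} {ξ η : L.Filt} (hξ : ξ ∈ L.letterSet a) (h : ξ.1 ⊆ η.1) :
    η ∈ L.letterSet a := ξ.2.subset_iff.1 h _ hξ

theorem rangeSet_of_subset {a : 𝓐} {ξ η : L.Filt} (hξ : ξ ∈ L.rangeSet a) (h : ξ.1 ⊆ η.1) :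
    η ∈ L.rangeSet a := ξ.2.subset_iff.1 h _ hξ

/-- Every filter above one in `letterSet` or `rangeSet` lies in the same set, so maximality can be
tested inside these sets, where the shift is an order isomorphism. -/
theorem shiftHomeomorph_mem_ultraSet (hL : L.IsWeaklyLeftResolving) (a : 𝓐) (ξ : L.letterSet a) :
    (shiftHomeomorph hL a ξ).1 ∈ L.ultraSet ↔ ξ.1 ∈ L.ultraSet := by
  constructor
  · intro h η hη
    have hm := shiftHomeomorph_mono hL a (η := ⟨η, letterSet_of_subset ξ.2 hη⟩) hη
    have := (shiftHomeomorph hL a).injective (Subtype.ext (Subtype.ext (h _ hm)))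
    exact congrArg (fun ζ => ζ.1.1) this
  · intro h η hη
    obtain ⟨ζ, hζ⟩ := (shiftHomeomorph hL a).surjective
      ⟨η, rangeSet_of_subset (shiftHomeomorph hL a ξ).2 hη⟩
    have hm := shiftHomeomorph_symm_mono hL a (ξ := shiftHomeomorph hL a ξ)
      (η := shiftHomeomorph hL a ζ) (by rwa [hζ])
    rw [Homeomorph.symm_apply_apply, Homeomorph.symm_apply_apply] at hm
    have := h _ hm
    obtain rfl : ζ = ξ := Subtype.ext (Subtype.ext this)
    rw [hζ]

/-- Preimages under continuous open maps commute with closure. Both the inclusion of `U` and `h`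
followed by the inclusion of `W` are such maps, and they pull `P` back to the same set. -/
theorem _root_.Homeomorph.mem_closure_iff_of_isOpen {X : Type*} [TopologicalSpace X]
    {U W P : Set X} (h : U ≃ₜ W) (hU : IsOpen U) (hW : IsOpen W)
    (hP : ∀ x, (h x).1 ∈ P ↔ x.1 ∈ P) (x : U) : (h x).1 ∈ closure P ↔ x.1 ∈ closure P := by
  have h1 := hU.isOpenMap_subtype_val.preimage_closure_eq_closure_preimage
    continuous_subtype_val P
  have h2 := (hW.isOpenMap_subtype_val.comp h.isOpenMap).preimage_closure_eq_closure_preimage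
    (continuous_subtype_val.comp h.continuous) P
  have h3 : (Subtype.val ∘ h) ⁻¹' P = (Subtype.val : U → X) ⁻¹' P := Set.ext hP
  rw [h3, ← h1] at h2
  exact Set.ext_iff.1 h2 x

theorem shiftHomeomorph_mem_tightSet (hL : L.IsWeaklyLeftResolving) (a : 𝓐) (ξ : L.letterSet a) :
    (shiftHomeomorph hL a ξ).1 ∈ L.tightSet ↔ ξ.1 ∈ L.tightSet :=
  (shiftHomeomorph hL a).mem_closure_iff_of_isOpen (isClopen_mem_comp _ _).isOpen
    (isClopen_mem_comp _ _).isOpen (shiftHomeomorph_mem_ultraSet hL a) ξ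

theorem mem_basicOpen_letterIdem {a : 𝓐} {ξ : L.Tight} :
    ξ ∈ L.basicOpen (L.letterIdem a) ↔ ξ.1 ∈ L.letterSet a :=
  (mem_comp (L.isTriple_letter a)).symm

theorem mem_basicOpen_rangeIdem {a : 𝓐} {ξ : L.Tight} :
    ξ ∈ L.basicOpen (L.rangeIdem a) ↔ ξ.1 ∈ L.rangeSet a :=
  (mem_comp (L.isTriple_nil a)).symm

/-- Removing the first letter `a`, as a homeomorphism between sets of tight filters. -/
noncomputable def tightHomeomorph (hL : L.IsWeaklyLeftResolving) (a : 𝓐) :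
    L.basicOpen (L.letterIdem a) ≃ₜ L.basicOpen (L.rangeIdem a) where
  toFun ξ := ⟨⟨(shiftHomeomorph hL a ⟨ξ.1.1, mem_basicOpen_letterIdem.1 ξ.2⟩).1,
    (shiftHomeomorph_mem_tightSet hL a _).2 ξ.1.2⟩, mem_basicOpen_rangeIdem.2 (shiftHomeomorph hL a _).2⟩
  invFun η := ⟨⟨((shiftHomeomorph hL a).symm ⟨η.1.1, mem_basicOpen_rangeIdem.1 η.2⟩).1, by
    rw [← shiftHomeomorph_mem_tightSet hL a, Homeomorph.apply_symm_apply]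
    exact η.1.2⟩, mem_basicOpen_letterIdem.2 ((shiftHomeomorph hL a).symm _).2⟩
  left_inv ξ := by
    refine Subtype.ext (Subtype.ext ?_)
    simp
  right_inv η := by
    refine Subtype.ext (Subtype.ext ?_)
    simp
  continuous_toFun := by
    refine Continuous.subtype_mk (Continuous.subtype_mk ?_ _) _
    exact continuous_subtype_val.comp ((shiftHomeomorph hL a).continuous.comp
      ((continuous_subtype_val.comp continuous_subtype_val).subtype_mk _))
  continuous_invFun := by
    refine Continuous.subtype_mk (Continuous.subtype_mk ?_ _) _
    exact continuous_subtype_val.comp ((shiftHomeomorph hL a).symm.continuous.comp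
      ((continuous_subtype_val.comp continuous_subtype_val).subtype_mk _))

theorem comp_tightHomeomorph (hL : L.IsWeaklyLeftResolving) (a : 𝓐)
    (ξ : L.basicOpen (L.letterIdem a)) :
    L.comp (tightHomeomorph hL a ξ).1.1.1 = L.shiftFamily a (L.comp ξ.1.1.1) :=
  comp_shiftHomeomorph hL a ⟨ξ.1.1, mem_basicOpen_letterIdem.1 ξ.2⟩

end LabelledSpace

/-! ### Finite and infinite words and their beginnings. -/

namespace LWord

variable {𝓐 : Type*}

theorem prepend_nil (γ : LWord 𝓐) : prepend [] γ = γ := by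
  cases γ <;> rfl

theorem prepend_append (α β : List 𝓐) (γ : LWord 𝓐) :
    prepend (α ++ β) γ = prepend α (prepend β γ) := by
  cases γ with
  | fin l => exact congrArg fin (List.append_assoc α β l)
  | inf x => exact congrArg inf (Stream'.append_append_stream α β x)

theorem prepend_cons (a : 𝓐) (α : List 𝓐) (γ : LWord 𝓐) :
    prepend (a :: α) γ = prepend [a] (prepend α γ) :=
  prepend_append [a] α γ

theorem prepend_singleton_injective {a b : 𝓐} {γ δ : LWord 𝓐} (h : prepend [a] γ = prepend [b] δ) :
    a = b ∧ γ = δ := by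
  cases γ <;> cases δ <;> simp only [prepend, fin.injEq, inf.injEq, reduceCtorEq] at h
  · simpa using h
  · have h' := Stream'.cons_injective2 (a₁ := a) (a₂ := b) h
    exact ⟨h'.1, congrArg inf h'.2⟩

theorem isBeginning_nil (α : LWord 𝓐) : IsBeginning [] α := ⟨α, (prepend_nil α).symm⟩

theorem isBeginning_prepend (α : List 𝓐) (γ : LWord 𝓐) : IsBeginning α (prepend α γ) := ⟨γ, rfl⟩

theorem isBeginning_cons_iff {a b : 𝓐} {β : List 𝓐} {γ : LWord 𝓐} :
    IsBeginning (a :: β) (prepend [b] γ) ↔ a = b ∧ IsBeginning β γ := by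
  constructor
  · rintro ⟨δ, h⟩
    rw [prepend_cons a β] at h
    obtain ⟨rfl, rfl⟩ := prepend_singleton_injective h
    exact ⟨rfl, δ, rfl⟩
  · rintro ⟨rfl, δ, rfl⟩
    exact ⟨δ, (prepend_cons _ _ _).symm⟩

theorem isBeginning_fin {β l : List 𝓐} : IsBeginning β (fin l) ↔ β <+: l := by
  constructor
  · rintro ⟨γ | x, h⟩
    · exact ⟨γ, (fin.inj h).symm⟩
    · cases h
  · rintro ⟨t, rfl⟩
    exact ⟨fin t, rfl⟩

theorem isBeginning_inf {β : List 𝓐} {x : Stream' 𝓐} :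
    IsBeginning β (inf x) ↔ β = x.take β.length := by
  constructor
  · rintro ⟨γ | y, h⟩
    · cases h
    · obtain rfl := inf.inj h
      rw [Stream'.take_append_of_le_length _ _ _ le_rfl, List.take_length]
  · intro h
    refine ⟨inf (x.drop β.length), congrArg inf ?_⟩
    have h' := Stream'.append_take_drop β.length x
    rw [← h] at h'
    exact h'.symm

theorem exists_eq_prepend_singleton {α : LWord 𝓐} (h : 1 ≤ α.length) :
    ∃ a γ, α = prepend [a] γ := by
  cases α with
  | fin l =>
    cases l with
    | nil => simp [length] at h
    | cons a l => exact ⟨a, fin l, rfl⟩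
  | inf x => exact ⟨x.head, inf x.tail, congrArg inf (Stream'.eta x).symm⟩

theorem one_le_length_prepend_singleton (a : 𝓐) (γ : LWord 𝓐) : 1 ≤ (prepend [a] γ).length := by
  cases γ with
  | fin l => simp [prepend, length]
  | inf x => exact le_top

theorem eq_of_isBeginning_iff {α β : LWord 𝓐}
    (h : ∀ γ : List 𝓐, γ ≠ [] → (IsBeginning γ α ↔ IsBeginning γ β)) : α = β := by
  have h' (γ : List 𝓐) : IsBeginning γ α ↔ IsBeginning γ β := by
    obtain rfl | hγ := eq_or_ne γ []
    · exact iff_of_true (isBeginning_nil α) (isBeginning_nil β)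
    · exact h γ hγ
  -- A finite word has no beginning of length `l.length + 1`, an infinite one does.
  have key (l : List 𝓐) (x : Stream' 𝓐)
      (h : ∀ γ, IsBeginning γ (fin l) ↔ IsBeginning γ (inf x)) : False := by
    have := ((h (x.take (l.length + 1))).2 (isBeginning_inf.2 (by simp)))
    have := (isBeginning_fin.1 this).length_le
    simp at this
  cases α with
  | fin l =>
    cases β with
    | fin m =>
      have h1 := isBeginning_fin.1 ((h' l).1 (isBeginning_fin.2 List.prefix_rfl))
      have h2 := isBeginning_fin.1 ((h' m).2 (isBeginning_fin.2 List.prefix_rfl))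
      rw [h1.eq_of_length_le h2.length_le]
    | inf y => exact (key l y h').elim
  | inf x =>
    cases β with
    | fin m => exact (key m x fun γ => (h' γ).symm).elim
    | inf y =>
      refine congrArg inf (Stream'.take_theorem _ _ fun n => ?_)
      have := isBeginning_inf.1 ((h' (x.take n)).1 (isBeginning_inf.2 (by simp)))
      simpa using this

/-- A set of words that is closed under beginnings and totally ordered by them consists of the
finite beginnings of some word. -/
theorem exists_isBeginning_iff {P : List 𝓐 → Prop} (hnil : P [])
    (hP : ∀ α β, P (α ++ β) → P α) (hc : ∀ α β, P α → P β → α <+: β ∨ β <+: α) :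
    ∃ α : LWord 𝓐, ∀ β, P β ↔ IsBeginning β α := by
  have hle {α β : List 𝓐} (hα : P α) (hβ : P β) (h : α.length ≤ β.length) : α <+: β := by
    obtain h' | h' := hc α β hα hβ
    · exact h'
    · rw [h'.eq_of_length_le h]
  -- If lengths are bounded, a longest member is the word; otherwise there are members of every
  -- length, and they cohere to a stream.
  by_cases hb : ∃ n, ∀ β, P β → β.length ≤ n
  · obtain ⟨α, hα, hmax⟩ : ∃ α, P α ∧ ∀ β, P β → β.length ≤ α.length := by
      classical
      have hspec := Nat.find_spec hb
      by_contra! hn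
      obtain ⟨β, hβ, hβl⟩ := hn [] hnil
      -- Minimality of the bound yields a member whose length attains it; a still longer member is
      -- then a contradiction. The bound is positive because `[]` is not longest.
      have hmin : ¬∀ β, P β → β.length ≤ Nat.find hb - 1 :=
        Nat.find_min hb (by have := hspec β hβ; simp at hβl; omega)
      push Not at hmin
      obtain ⟨δ, hδ, hδl⟩ := hmin
      obtain ⟨ζ, hζ, hζl⟩ := hn δ hδ
      have := hspec ζ hζ
      omega
    refine ⟨fin α, fun β => ⟨fun hβ => isBeginning_fin.2 (hle hβ hα (hmax β hβ)), fun h => ?_⟩⟩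
    obtain ⟨t, rfl⟩ := isBeginning_fin.1 h
    exact hP _ _ hα
  · push Not at hb
    have hex (n : ℕ) : ∃ β, P β ∧ β.length = n := by
      obtain ⟨β, hβ, hn⟩ := hb n
      refine ⟨β.take n, hP _ (β.drop n) (by rwa [List.take_append_drop]), ?_⟩
      rw [List.length_take]
      omega
    choose w hw hwl using hex
    have hlt (n : ℕ) : n < (w (n + 1)).length := by rw [hwl]; exact n.lt_succ_self
    let x : Stream' 𝓐 := fun n => (w (n + 1))[n]'(hlt n)
    have hx (n : ℕ) : w n = x.take n := by
      refine List.ext_getElem (by simp [hwl]) fun i h1 h2 => ?_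
      rw [Stream'.take_get]
      have hi : w (i + 1) <+: w n := hle (hw _) (hw _) (by rw [hwl] at h1 ⊢; rw [hwl]; exact h1)
      exact (hi.getElem (hlt i)).symm
    refine ⟨inf x, fun β => ?_⟩
    rw [isBeginning_inf, ← hx]
    constructor
    · intro hβ
      exact (hle hβ (hw _) (hwl _).ge).eq_of_length (hwl _).symm
    · intro h
      rw [h]
      exact hw _

end LWord

/-! ### Powers of a partial map and the Renault–Deaconu groupoid. -/

namespace PartialMap

variable {X : Type*} {U : Set X} {σ : U → X}

theorem mem_pow_zero {x y : X} : y ∈ pow (ofFun U σ) 0 x ↔ y = x :=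
  Part.mem_some_iff

theorem mem_pow_succ {n : ℕ} {x y : X} :
    y ∈ pow (ofFun U σ) (n + 1) x ↔ ∃ hx : x ∈ U, y ∈ pow (ofFun U σ) n (σ ⟨x, hx⟩) := by
  change y ∈ ((pow (ofFun U σ) n).comp (ofFun U σ)) x ↔ _
  rw [PFun.comp_apply]
  refine Part.mem_bind_iff.trans ?_
  constructor
  · rintro ⟨_, ⟨hx, rfl⟩, hy⟩
    exact ⟨hx, hy⟩
  · rintro ⟨hx, hy⟩
    exact ⟨_, ⟨hx, rfl⟩, hy⟩

end PartialMap

theorem mem_renaultDeaconu_iff {X : Type*} {U : Set X} {σ : U → X} {g : X × ℤ × X} :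
    g ∈ renaultDeaconu U σ ↔ ∃ (m n : ℕ) (y : X), g.2.1 = (m : ℤ) - (n : ℤ) ∧
      y ∈ PartialMap.pow (PartialMap.ofFun U σ) m g.1 ∧
      y ∈ PartialMap.pow (PartialMap.ofFun U σ) n g.2.2 := by
  constructor
  · rintro ⟨m, n, hx, hy, h, h'⟩
    exact ⟨m, n, _, h, ⟨hx, rfl⟩, ⟨hy, h'.symm⟩⟩
  · rintro ⟨m, n, y, h, ⟨hx, hx'⟩, ⟨hy, hy'⟩⟩
    exact ⟨m, n, hx, hy, h, hx'.trans hy'.symm⟩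

/-! ### The word of a filter, the shift `σ` and the groupoid. -/

namespace LabelledSpace

variable {V E 𝓐 : Type*} {L : LabelledSpace V E 𝓐}

theorem HasWord.unique {ξ : Set L.S} {α β : LWord 𝓐} (hα : L.HasWord ξ α) (hβ : L.HasWord ξ β) :
    α = β :=
  LWord.eq_of_isBeginning_iff fun γ hγ => (hα γ hγ).symm.trans (hβ γ hγ)

theorem Filt.exists_hasWord (ξ : L.Filt) : ∃ α, L.HasWord ξ.1 α := by
  have hF := ξ.isFilterFamily
  -- The empty word is admitted separately, since `comp ξ.1 []` may be empty.
  obtain ⟨α, hα⟩ := LWord.exists_isBeginning_iff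
    (P := fun β => β = [] ∨ (L.comp ξ.1 β).Nonempty) (Or.inl rfl) (by
      intro α β h
      obtain rfl | hα := eq_or_ne α []
      · exact Or.inl rfl
      · obtain h | h := h
        · exact Or.inl (List.append_eq_nil_iff.1 h).1
        · exact Or.inr ⟨_, hF.range_mem h hα⟩) (by
      rintro α β (rfl | hα) hβ
      · exact Or.inl List.nil_prefix
      obtain rfl | hβ := hβ
      · exact Or.inr List.nil_prefix
      refine (hF.comparable hα hβ).imp ?_ ?_ <;>
      · rintro ⟨γ, rfl⟩
        exact List.prefix_append _ _)
  refine ⟨α, fun β hβ => ?_⟩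
  rw [← hα β]
  exact (or_iff_right hβ).symm

theorem HasWord.mem_letterSet {ξ : L.Filt} {a : 𝓐} {γ : LWord 𝓐}
    (h : L.HasWord ξ.1 (LWord.prepend [a] γ)) : ξ ∈ L.letterSet a :=
  ξ.isFilterFamily.range_mem (β := [])
    ((h [a] (List.cons_ne_nil _ _)).2 (LWord.isBeginning_prepend _ _)) (List.cons_ne_nil _ _)

theorem exists_hasWord_of_mem_letterSet {ξ : L.Filt} {a : 𝓐} (h : ξ ∈ L.letterSet a) :
    ∃ γ, L.HasWord ξ.1 (LWord.prepend [a] γ) := by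
  obtain ⟨α, hα⟩ := ξ.exists_hasWord
  obtain ⟨γ, rfl⟩ := (hα [a] (List.cons_ne_nil _ _)).1 ⟨_, h⟩
  exact ⟨γ, hα⟩

theorem tightGE_one : L.tightGE 1 = ⋃ a, L.basicOpen (L.letterIdem a) := by
  ext ξ
  rw [Set.mem_iUnion]
  constructor
  · rintro ⟨α, hα, h⟩
    obtain ⟨a, γ, rfl⟩ := LWord.exists_eq_prepend_singleton (by simpa using h)
    exact ⟨a, mem_basicOpen_letterIdem.2 hα.mem_letterSet⟩
  · rintro ⟨a, ha⟩
    obtain ⟨γ, hγ⟩ := exists_hasWord_of_mem_letterSet (mem_basicOpen_letterIdem.1 ha)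
    exact ⟨_, hγ, by simpa using LWord.one_le_length_prepend_singleton a γ⟩

theorem isOpen_basicOpen_letterIdem (a : 𝓐) : IsOpen (L.basicOpen (L.letterIdem a)) := by
  have h := (isClopen_mem_comp (L := L) [a] (L.range [a])).isOpen.preimage
    (continuous_subtype_val (p := (· ∈ L.tightSet)))
  convert h using 1
  ext ξ
  exact mem_basicOpen_letterIdem

theorem isOpen_tightGE_one : IsOpen (L.tightGE 1) := by
  rw [tightGE_one]
  exact isOpen_iUnion isOpen_basicOpen_letterIdem

theorem letter_unique {ξ : L.Filt} {a b : 𝓐} (ha : ξ ∈ L.letterSet a) (hb : ξ ∈ L.letterSet b) :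
    a = b := by
  obtain ⟨γ, hγ⟩ := exists_hasWord_of_mem_letterSet ha
  obtain ⟨δ, hδ⟩ := exists_hasWord_of_mem_letterSet hb
  exact (LWord.prepend_singleton_injective (hγ.unique hδ)).1

theorem exists_mem_basicOpen_letterIdem (ξ : L.tightGE 1) :
    ∃ a, ξ.1 ∈ L.basicOpen (L.letterIdem a) :=
  Set.mem_iUnion.1 (tightGE_one ▸ ξ.2)

/-- The map that removes the first letter. -/
noncomputable def tightShift (hL : L.IsWeaklyLeftResolving) (ξ : L.tightGE 1) : L.Tight :=
  (tightHomeomorph hL _ ⟨ξ.1, (exists_mem_basicOpen_letterIdem ξ).choose_spec⟩).1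

/-- The chosen letter is irrelevant, as a filter has only one first letter. -/
theorem tightShift_eq (hL : L.IsWeaklyLeftResolving) (ξ : L.tightGE 1) {a : 𝓐}
    (ha : ξ.1 ∈ L.basicOpen (L.letterIdem a)) :
    tightShift hL ξ = (tightHomeomorph hL a ⟨ξ.1, ha⟩).1 := by
  have h := letter_unique (mem_basicOpen_letterIdem.1 ha)
    (mem_basicOpen_letterIdem.1 (exists_mem_basicOpen_letterIdem ξ).choose_spec)
  subst h
  rfl

theorem comp_tightShift (hL : L.IsWeaklyLeftResolving) (ξ : L.tightGE 1) {a : 𝓐}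
    (ha : ξ.1.1 ∈ L.letterSet a) :
    L.comp (tightShift hL ξ).1.1 = L.shiftFamily a (L.comp ξ.1.1.1) := by
  rw [tightShift_eq hL ξ (mem_basicOpen_letterIdem.2 ha)]
  exact comp_tightHomeomorph hL a _

theorem isLocalHomeomorph_tightShift (hL : L.IsWeaklyLeftResolving) :
    IsLocalHomeomorph (tightShift hL) := by
  rw [isLocalHomeomorph_iff_isOpenEmbedding_restrict]
  intro ξ
  obtain ⟨a, ha⟩ := exists_mem_basicOpen_letterIdem ξ
  let U : Set (L.tightGE 1) := {ζ | ζ.1 ∈ L.basicOpen (L.letterIdem a)}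
  have hU : IsOpen U := (isOpen_basicOpen_letterIdem a).preimage continuous_subtype_val
  -- On the open set `U`, `tightShift` factors as `j`, the homeomorphism for `a`, and an open
  -- inclusion.
  let j : U → L.basicOpen (L.letterIdem a) := fun ζ => ⟨ζ.1.1, ζ.2⟩
  have hj : Topology.IsOpenEmbedding j := by
    refine Topology.IsOpenEmbedding.of_comp j
      (isOpen_basicOpen_letterIdem a).isOpenEmbedding_subtypeVal ?_
    exact isOpen_tightGE_one.isOpenEmbedding_subtypeVal.comp hU.isOpenEmbedding_subtypeVal
  have hr : IsOpen (L.basicOpen (L.rangeIdem a)) := by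
    have h := (isClopen_mem_comp (L := L) [] (L.range [a])).isOpen.preimage
      (continuous_subtype_val (p := (· ∈ L.tightSet)))
    convert h using 1
    ext ζ
    exact mem_basicOpen_rangeIdem
  refine ⟨U, hU.mem_nhds ha, ?_⟩
  convert hr.isOpenEmbedding_subtypeVal.comp
    ((tightHomeomorph hL a).isOpenEmbedding.comp hj) using 1
  ext1 ζ
  exact tightShift_eq hL ζ.1 ζ.2

theorem comp_cut {ξ : L.Filt} {α : List 𝓐} {γ : LWord 𝓐} (hα : α ≠ [])
    (hξ : L.HasWord ξ.1 (LWord.prepend α γ)) (β : List 𝓐) :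
    L.comp (L.cut α γ ξ.1) β = L.cutFilter β (L.comp ξ.1 (α ++ β)) := by
  ext C
  constructor
  · rintro ⟨h, ⟨h', -⟩ | ⟨-, δ, -, D, hD, hD', heq⟩⟩
    · exact absurd h' hα
    · rw [S.triple.injEq] at heq
      obtain ⟨rfl, rfl, -⟩ := heq
      exact hD
  · intro hC
    obtain ⟨hC', D, hD, hDC⟩ := hC
    have ht : L.IsTriple β C β := isTriple_iff.2 ⟨hC'.1, hC'.2, hD.1.nonempty.mono hDC⟩
    refine ⟨ht, Or.inr ⟨hα, β, ?_, C, ⟨hC', D, hD, hDC⟩, ht, rfl⟩⟩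
    -- Since `αβ` is a beginning of `αγ`, stripping the letters of `α` shows that `β` is a beginning
    -- of `γ`, as `cut` requires.
    have hb := (hξ (α ++ β) (by simp [hα])).1 ⟨D, hD⟩
    clear hξ hD
    induction α with
    | nil => exact absurd rfl hα
    | cons a α ih =>
      rw [List.cons_append, LWord.prepend_cons] at hb
      replace hb := (LWord.isBeginning_cons_iff.1 hb).2
      obtain rfl | hne := eq_or_ne α []
      · rwa [LWord.prepend_nil] at hb
      · exact ih hne hb

theorem ofFamily_comp_cut {ξ : L.Filt} {α : List 𝓐} {γ : LWord 𝓐} (hα : α ≠ []) :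
    L.ofFamily (L.comp (L.cut α γ ξ.1)) = L.cut α γ ξ.1 := by
  ext e
  constructor
  · rintro ⟨β, C, h, hC, rfl⟩
    exact hC.2
  · intro he
    obtain ⟨h', -⟩ | ⟨-, β, -, C, -, h, rfl⟩ := id he
    · exact absurd h' hα
    · exact ⟨β, C, h, ⟨h, he⟩, rfl⟩

theorem HasWord.mem_tightGE_one {ξ : L.Tight} {a : 𝓐} {γ : LWord 𝓐}
    (h : L.HasWord ξ.1.1 (LWord.prepend [a] γ)) : ξ ∈ L.tightGE 1 :=
  ⟨_, h, by simpa using LWord.one_le_length_prepend_singleton a γ⟩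

/-- Members of `ξ` at `aβ` already lie in `r(aβ)`, so one contained in `C` is contained in `C ∩
r(aβ)`. -/
theorem comp_tightShift_eq_cutFilter (hL : L.IsWeaklyLeftResolving) (ξ : L.tightGE 1) {a : 𝓐}
    {γ : LWord 𝓐} (h : L.HasWord ξ.1.1.1 (LWord.prepend [a] γ)) (β : List 𝓐) :
    L.comp (tightShift hL ξ).1.1 β = L.cutFilter β (L.comp ξ.1.1.1 (a :: β)) := by
  have hF := ξ.1.1.isFilterFamily
  rw [comp_tightShift hL ξ h.mem_letterSet]
  ext C
  refine and_congr_right fun hC => ⟨fun h => ⟨_, h, Set.inter_subset_left⟩, ?_⟩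
  rintro ⟨D, hD, hDC⟩
  have ht := hF.isTriple hD
  exact hF.mem_of_superset hD
    (L.inter_mem _ hC.1 _ (isTriple_range ht.left (List.cons_ne_nil _ _)).mem_left.1)
    Set.inter_subset_right (Set.subset_inter hDC ht.mem_left.2)

theorem tightShift_eq_cut (hL : L.IsWeaklyLeftResolving) (ξ : L.tightGE 1) {a : 𝓐}
    {γ : LWord 𝓐} (h : L.HasWord ξ.1.1.1 (LWord.prepend [a] γ)) :
    (tightShift hL ξ).1.1 = L.cut [a] γ ξ.1.1.1 := by
  have hne : [a] ≠ [] := List.cons_ne_nil _ _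
  rw [← (tightShift hL ξ).1.2.ofFamily_comp, ← ofFamily_comp_cut hne]
  congr 1
  ext1 β
  rw [comp_cut hne h]
  exact comp_tightShift_eq_cutFilter hL ξ h β

theorem hasWord_tightShift (hL : L.IsWeaklyLeftResolving) (ξ : L.tightGE 1) {a : 𝓐}
    {γ : LWord 𝓐} (h : L.HasWord ξ.1.1.1 (LWord.prepend [a] γ)) :
    L.HasWord (tightShift hL ξ).1.1 γ := by
  intro β hβ
  rw [comp_tightShift_eq_cutFilter hL ξ h,
    ← (LWord.isBeginning_cons_iff.trans (and_iff_right rfl) :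
      LWord.IsBeginning (a :: β) (LWord.prepend [a] γ) ↔ _), ← h _ (List.cons_ne_nil _ _)]
  constructor
  · rintro ⟨C, -, D, hD, -⟩
    exact ⟨D, hD⟩
  · rintro ⟨D, hD⟩
    have ht := hD.1.mem_left
    exact ⟨D, ⟨ht.1, ht.2.trans (L.range_cons_subset a β)⟩, D, hD, subset_rfl⟩

theorem cut_nil (γ : LWord 𝓐) (ξ : Set L.S) : L.cut [] γ ξ = ξ := by
  ext e
  simp [cut]

/-- Two successive enlargements of a member amount to one by transitivity of inclusion; conversely a
member at `aαβ` is itself a member at `αβ` after the shift. The case `α = []` is separate because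
`cut` is then the identity. -/
theorem cut_tightShift (hL : L.IsWeaklyLeftResolving) (ξ : L.tightGE 1) {a : 𝓐} {α : List 𝓐}
    {γ : LWord 𝓐} (h : L.HasWord ξ.1.1.1 (LWord.prepend (a :: α) γ)) :
    L.cut α γ (tightShift hL ξ).1.1 = L.cut (a :: α) γ ξ.1.1.1 := by
  have h' := h
  rw [LWord.prepend_cons] at h'
  obtain rfl | hα := eq_or_ne α []
  · rw [cut_nil]
    exact tightShift_eq_cut hL ξ h
  · rw [← ofFamily_comp_cut hα, ← ofFamily_comp_cut (List.cons_ne_nil a α)]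
    congr 1
    ext β C
    rw [comp_cut hα (hasWord_tightShift hL ξ h'), comp_cut (List.cons_ne_nil a α) h,
      comp_tightShift_eq_cutFilter hL ξ h']
    refine and_congr_right fun _ => ⟨?_, ?_⟩
    · rintro ⟨D, ⟨-, D', hD', hD'D⟩, hDC⟩
      exact ⟨D', hD', hD'D.trans hDC⟩
    · rintro ⟨D, hD, hDC⟩
      have ht := hD.1.mem_left
      exact ⟨D, ⟨⟨ht.1, ht.2.trans (L.range_cons_subset a (α ++ β))⟩, D, hD, subset_rfl⟩, hDC⟩

theorem exists_mem_pow_tightShift (hL : L.IsWeaklyLeftResolving) {α : List 𝓐} {γ : LWord 𝓐}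
    {ξ : L.Tight} (h : L.HasWord ξ.1.1 (LWord.prepend α γ)) :
    ∃ ζ ∈ PartialMap.pow (PartialMap.ofFun (L.tightGE 1) (tightShift hL)) α.length ξ,
      ζ.1.1 = L.cut α γ ξ.1.1 ∧ L.HasWord ζ.1.1 γ := by
  induction α generalizing ξ with
  | nil =>
    refine ⟨ξ, PartialMap.mem_pow_zero.2 rfl, (cut_nil γ _).symm, ?_⟩
    rwa [LWord.prepend_nil] at h
  | cons a α ih =>
    have h' := h
    rw [LWord.prepend_cons] at h'
    have hξ := h'.mem_tightGE_one
    obtain ⟨ζ, h1, h2, h3⟩ := ih (hasWord_tightShift hL ⟨ξ, hξ⟩ h')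
    exact ⟨ζ, PartialMap.mem_pow_succ.2 ⟨hξ, h1⟩, h2.trans (cut_tightShift hL ⟨ξ, hξ⟩ h), h3⟩

theorem exists_hasWord_of_mem_pow_tightShift (hL : L.IsWeaklyLeftResolving) {m : ℕ}
    {ξ ζ : L.Tight}
    (h : ζ ∈ PartialMap.pow (PartialMap.ofFun (L.tightGE 1) (tightShift hL)) m ξ) :
    ∃ (α : List 𝓐) (γ : LWord 𝓐), α.length = m ∧ L.HasWord ξ.1.1 (LWord.prepend α γ) := by
  induction m generalizing ξ with
  | zero =>
    obtain ⟨γ, hγ⟩ := ξ.1.exists_hasWord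
    exact ⟨[], γ, rfl, by rwa [LWord.prepend_nil]⟩
  | succ m ih =>
    obtain ⟨hξ, h'⟩ := PartialMap.mem_pow_succ.1 h
    obtain ⟨α, γ, hα, hw⟩ := ih h'
    obtain ⟨a, ha⟩ := exists_mem_basicOpen_letterIdem ⟨ξ, hξ⟩
    obtain ⟨δ, hδ⟩ := exists_hasWord_of_mem_letterSet (mem_basicOpen_letterIdem.1 ha)
    -- The tail of the word of `ξ` is the word of its shift, already known from the induction.
    obtain rfl := (hasWord_tightShift hL ⟨ξ, hξ⟩ hδ).unique hw
    exact ⟨a :: α, γ, by simp [hα], by rwa [LWord.prepend_cons]⟩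

theorem groupoidSet_eq_renaultDeaconu (hL : L.IsWeaklyLeftResolving) :
    L.groupoidSet = renaultDeaconu (L.tightGE 1) (tightShift hL) := by
  ext ⟨ξ, k, η⟩
  rw [mem_renaultDeaconu_iff]
  constructor
  · rintro ⟨α, β, γ, hξ, hη, hk, hcut⟩
    obtain ⟨ζ, h1, h2, -⟩ := exists_mem_pow_tightShift hL hξ
    obtain ⟨ζ', h1', h2', -⟩ := exists_mem_pow_tightShift hL hη
    obtain rfl : ζ = ζ' := Subtype.ext (Subtype.ext (h2.trans (hcut.trans h2'.symm)))
    exact ⟨_, _, ζ, hk, h1, h1'⟩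
  · rintro ⟨m, n, ζ, hk, hm, hn⟩
    obtain ⟨α, γ, rfl, hξ⟩ := exists_hasWord_of_mem_pow_tightShift hL hm
    obtain ⟨β, δ, rfl, hη⟩ := exists_hasWord_of_mem_pow_tightShift hL hn
    obtain ⟨ζ₁, h1, h2, h3⟩ := exists_mem_pow_tightShift hL hξ
    obtain ⟨ζ₂, h1', h2', h3'⟩ := exists_mem_pow_tightShift hL hη
    obtain rfl := Part.mem_unique hm h1
    obtain rfl := Part.mem_unique hn h1'
    -- Both tails are the word of the common value `ζ`, so a single `γ` serves for `ξ` and `η`.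
    obtain rfl := h3.unique h3'
    exact ⟨α, β, γ, hξ, hη, hk, h2.symm.trans h2'⟩

end LabelledSpace

theorem mainTheorem4 {V E 𝓐 : Type*} (L : LabelledSpace V E 𝓐)
    (hL : L.IsWeaklyLeftResolving) (hN : L.IsNormal) :
    IsOpen (L.tightGE 1) ∧
    ∃ σ : L.tightGE 1 → L.Tight,
      (∀ (ξ : L.tightGE 1) (a : 𝓐) (γ : LWord 𝓐),
        L.HasWord ξ.1.1.1 (LWord.prepend [a] γ) → (σ ξ).1.1 = L.cut [a] γ ξ.1.1.1) ∧
      IsLocalHomeomorph σ ∧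
      (∀ a : 𝓐, L.basicOpen (L.letterIdem a) ⊆ L.tightGE 1 ∧
        ∃ φ : L.basicOpen (L.letterIdem a) ≃ₜ L.basicOpen (L.rangeIdem a),
          ∀ (ξ : L.basicOpen (L.letterIdem a)) (hξ : ξ.1 ∈ L.tightGE 1),
            (φ ξ).1 = σ ⟨ξ.1, hξ⟩) ∧
      L.groupoidSet = renaultDeaconu (L.tightGE 1) σ := by
  refine ⟨LabelledSpace.isOpen_tightGE_one, LabelledSpace.tightShift hL,
    fun ξ a γ h => LabelledSpace.tightShift_eq_cut hL ξ h,
    LabelledSpace.isLocalHomeomorph_tightShift hL,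
    fun a => ⟨?_, LabelledSpace.tightHomeomorph hL a, fun ξ hξ => ?_⟩,
    LabelledSpace.groupoidSet_eq_renaultDeaconu hL⟩
  · rw [LabelledSpace.tightGE_one]
    exact Set.subset_iUnion (fun a => L.basicOpen (L.letterIdem a)) a
  · exact (LabelledSpace.tightShift_eq hL ⟨ξ.1, hξ⟩ ξ.2).symm
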